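/- \textbf{Stochastic transition systems.} A \emph{stochastic transition system} (STS) is a triple $\mathcal T=(S,\Sigma,\kappa)$ where $(S,\Sigma)$ is a measurable space and $\kappa$ is a Markov kernel on it. For an initial probability distribution $\mu$ on $S$, let $\mathbb P^{\mathcal T}_\mu$ be the induced probability measure on infinite runs $s_0s_1s_2\dots\in S^{\mathbb N}$ (the law of the Markov chain with initial law $\mu$ and transition kernel $\kappa$), let $\mathbf F B$ be the event $\{\exists n,\ s_n\in B\}$, and let $\widetilde B=\{s\in S\mid \mathbb P^{\mathcal T}_{\delta_s}(\mathbf F B)=0\}$. The STS $\mathcal T$ is \emph{decisive} with respect to $B$ if $\mathbb P^{\mathcal T}_\mu(\mathbf F B\cup\mathbf F\widetilde B)=1$ for every probability distribution $\mu$ on $S$. \textbf{Stochastic hybrid systems.} A \emph{stochastic hybrid system} (SHS) $\mathcal H$ consists of a finite set $L$ of locations, a finite set of $n$ real variables, a finite alphabet $A$, a finite set $E\subseteq L\times A\times L$ of edges, continuous dynamics $\gamma_\ell:\mathbb R^n\times\mathbb R^+\to\mathbb R^n$ and an invariant $\mathcal I(\ell)\subseteq\mathbb R^n$ for each $\ell\in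 L$, a guard $\mathcal G(e)\subseteq\mathbb R^n$ and reset sets $\mathcal R_e(v)\subseteq\mathbb R^n$ ($v\in\mathbb R^n$) for each $e\in E$, together with the probability distributions described next. For $s=(\ell,v)\in L\times\mathbb R^n$ write $s+\tau=(\ell,\gamma_\ell(v,\tau))$. An edge $e$ is \emph{enabled} in $s$ if its source is $\ell$ and $v\in\mathcal G(e)$. Let $I(s)$ be the set of delays $\tau\ge 0$ such that $\gamma_\ell(v,\tau')\in\mathcal I(\ell)$ for all $0\le\tau'\le\tau$ and some edge is enabled in $s+\tau$. The state $s$ is \emph{blocked} if $I(s)=\emptyset$. The distributions are: \begin{itemize} \item for each state $s$ a probability distribution $\mu_s$ on delays in $\mathbb R^+$, with $\mu_s(I(s))=1$ if $s$ is not blocked; \item for each state $s$ in which some edge is enabled, a probability distribution $p_s$ on $E$, with $p_s(e)>0$ if and only if $e$ is enabled in $s$; \item for each $e\in E$ and $v\in\mathcal G(e)$ a probability distribution $\eta_e(v)$ on $\mathcal R_e(v)$. \end{itemize} All of these depend measurably on their parameters, and the set of blocked states is measurable. The STS $\mathcal T_{\mathcal H}$ induced by $\mathcal H$ has state space $L\times\mathbb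 R^n$ with the product of the discrete and Borel $\sigma$-algebras, and its kernel is \[ \kappa(s,B)=\int_{\mathbb R^+}\ \sum_{e=(\ell,a,\ell')\in E} p_{s+\tau}(e)\cdot \eta_e\bigl(\gamma_\ell(v,\tau)\bigr)\bigl(\{v'\mid(\ell',v')\in B\}\bigr)\,\mathrm d\mu_s(\tau) \] for a non-blocked state $s=(\ell,v)$; blocked states, if there are any, are absorbing. An edge $e$ is \emph{strongly reset} if there are a set $\mathcal R^*_e\subseteq\mathbb R^n$ and a probability distribution $\eta^*_e$ on $\mathcal R_e^*$ such that $\mathcal R_e(v)=\mathcal R_e^*$ and $\eta_e(v)=\eta_e^*$ for all $v\in\mathcal G(e)$. The SHS $\mathcal H$ is \emph{cycle-reset} if every cycle of edges of the directed multigraph $(L,E)$ contains a strongly reset edge. \textbf{Proposition.} Let $\mathcal H$ be a cycle-reset stochastic hybrid system. Then the STS $\mathcal T_{\mathcal H}$ is decisive with respect to every measurable set $B\subseteq L\times\mathbb R^n$. -/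

import Mathlib

open MeasureTheory ProbabilityTheory
open scoped ENNReal NNReal

/-! ## Stochastic transition systems -/

/-- A stochastic transition system on the measurable space `S` of states: a Markov kernel
`κ : S × Σ → [0, 1]`. -/
structure STS (S : Type*) [MeasurableSpace S] where
  /-- the transition probabilities -/
  kernel : Kernel S S
  /-- every `kernel s` is a probability measure -/
  isMarkov : IsMarkovKernel kernel

namespace STS

variable {S : Type*} [MeasurableSpace S]

instance (T : STS S) : IsMarkovKernel T.kernel := T.isMarkov

/-- The kernel giving the law of the next state as a function of the run up to time `n`: it
depends only on the state reached at time `n`. -/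
noncomputable def historyKernel (T : STS S) (n : ℕ) : Kernel ((_ : Finset.Iic n) → S) S :=
  T.kernel.comap (fun h => h ⟨n, Finset.mem_Iic.2 le_rfl⟩) (measurable_pi_apply _)

instance (T : STS S) (n : ℕ) : IsMarkovKernel (T.historyKernel n) := by
  unfold historyKernel; infer_instance

/-- `T.prob μ` is the probability measure on the infinite runs `ℕ → S` of `T` (with the
σ-algebra generated by the cylinders) for the initial distribution `μ`. -/
noncomputable def prob (T : STS S) (μ : Measure S) : Measure (ℕ → S) :=
  Kernel.trajMeasure (X := fun _ : ℕ => S) μ T.historyKernel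

/-- The event `F B`: the run visits the set `B`. -/
def eventually (B : Set S) : Set (ℕ → S) := {ρ | ∃ n, ρ n ∈ B}

/-- The avoid-set of `B`: the states from which `B` is almost surely never visited. -/
def avoid (T : STS S) (B : Set S) : Set S :=
  {s | T.prob (Measure.dirac s) (eventually B) = 0}

/-- `T` is decisive with respect to `B`: from every initial distribution, almost surely, the run
visits `B` or the avoid-set of `B`. -/
def Decisive (T : STS S) (B : Set S) : Prop :=
  ∀ μ : Measure S, IsProbabilityMeasure μ →
    T.prob μ (eventually B ∪ eventually (T.avoid B)) = 1

end STS

/-! ## Hybrid systems -/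

/-- A hybrid system with finite set `L` of locations, finite alphabet `A` of events and finite set
`X` of real variables. Valuations of the variables are elements of `X → ℝ`. -/
structure HybridSystem (L A X : Type*) [Finite L] [Finite A] [Finite X] where
  /-- the edges `(ℓ, a, ℓ')` -/
  edges : Finset (L × A × L)
  /-- the dynamics: `flow ℓ v τ` is the valuation after a delay `τ` in location `ℓ` from `v` -/
  flow : L → (X → ℝ) → ℝ≥0 → (X → ℝ)
  continuous_flow : ∀ ℓ, Continuous fun p : (X → ℝ) × ℝ≥0 => flow ℓ p.1 p.2
  /-- the invariant of a location -/
  inv : L → Set (X → ℝ)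
  /-- the guard of an edge -/
  guard : L × A × L → Set (X → ℝ)
  /-- the set of possible valuations after taking an edge from a given valuation -/
  resetSet : L × A × L → (X → ℝ) → Set (X → ℝ)

namespace HybridSystem

variable {L A X : Type*} [Finite L] [Finite A] [Finite X]

/-- `s + τ`: the state reached from `s` after a delay `τ`. -/
def delayState (H : HybridSystem L A X) (s : L × (X → ℝ)) (τ : ℝ≥0) : L × (X → ℝ) :=
  (s.1, H.flow s.1 s.2 τ)

/-- The edge `e` is enabled in the state `s`. -/
def Enabled (H : HybridSystem L A X) (s : L × (X → ℝ)) (e : L × A × L) : Prop :=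
  e ∈ H.edges ∧ e.1 = s.1 ∧ s.2 ∈ H.guard e

/-- `I(s, e)`: the delays after which, the invariant having held all along, the edge `e` is
enabled. -/
def edgeDelays (H : HybridSystem L A X) (s : L × (X → ℝ)) (e : L × A × L) : Set ℝ≥0 :=
  {τ | (∀ τ' ≤ τ, H.flow s.1 s.2 τ' ∈ H.inv s.1) ∧ H.Enabled (H.delayState s τ) e}

/-- `I(s)`: the delays after which some edge is enabled. -/
def delays (H : HybridSystem L A X) (s : L × (X → ℝ)) : Set ℝ≥0 :=
  {τ | ∃ e, τ ∈ H.edgeDelays s e}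

/-- The states from which no edge can be taken, whatever the delay (the hybrid system is
non-blocking if there is none). -/
def blocked (H : HybridSystem L A X) : Set (L × (X → ℝ)) :=
  {s | H.delays s = ∅}

/-- A cycle of the discrete graph: edges `c 0, …, c k`, each leading to the source of the next
one, and `c k` leading to the source of `c 0` (the addition of `Fin (k + 1)` is cyclic). -/
def IsCycle (H : HybridSystem L A X) {k : ℕ} (c : Fin (k + 1) → L × A × L) : Prop :=
  ∀ i, c i ∈ H.edges ∧ (c i).2.2 = (c (i + 1)).1

end HybridSystem

/-! ## Stochastic hybrid systems -/

/-- A stochastic hybrid system: a hybrid system with probability distributions on the delays, on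
the edges and on the resets. (`Kernel`s are families of measures which depend measurably on the
parameter.) -/
structure StochasticHybridSystem (L A X : Type*) [Finite L] [Finite A] [Finite X]
    [MeasurableSpace L] [DiscreteMeasurableSpace L] extends HybridSystem L A X where
  measurableSet_blocked : MeasurableSet toHybridSystem.blocked
  /-- the distribution of the delay before leaving a state -/
  delayDist : Kernel (L × (X → ℝ)) ℝ≥0
  isMarkov_delayDist : IsMarkovKernel delayDist
  /-- almost surely some edge is enabled after the delay, if this is possible at all -/
  delayDist_delays : ∀ s, s ∉ toHybridSystem.blocked →
    ∀ᵐ τ ∂(delayDist s), τ ∈ toHybridSystem.delays s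
  /-- the distribution on edges; only its values at the states with an enabled edge matter -/
  edgeDist : L × (X → ℝ) → L × A × L → ℝ≥0∞
  measurable_edgeDist : ∀ e ∈ edges, Measurable fun s => edgeDist s e
  sum_edgeDist : ∀ s, (∃ e, toHybridSystem.Enabled s e) → ∑ e ∈ edges, edgeDist s e = 1
  edgeDist_pos_iff : ∀ s, (∃ e, toHybridSystem.Enabled s e) →
    ∀ e ∈ edges, (0 < edgeDist s e ↔ toHybridSystem.Enabled s e)
  /-- the distribution of the valuation after taking an edge; only its values at the valuations
  which satisfy the guard of the edge matter -/
  resetDist : L × A × L → Kernel (X → ℝ) (X → ℝ)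
  isProbabilityMeasure_resetDist : ∀ e ∈ edges, ∀ v ∈ guard e,
    IsProbabilityMeasure (resetDist e v)
  resetDist_resetSet : ∀ e ∈ edges, ∀ v ∈ guard e, ∀ᵐ v' ∂(resetDist e v), v' ∈ resetSet e v

namespace StochasticHybridSystem

variable {L A X : Type*} [Finite L] [Finite A] [Finite X]
  [MeasurableSpace L] [DiscreteMeasurableSpace L]

instance (H : StochasticHybridSystem L A X) : IsMarkovKernel H.delayDist := H.isMarkov_delayDist

/-- The subprobability distribution of the next state, when the discrete transition is taken from
the state `s`: choose an edge, then a reset along this edge. -/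
noncomputable def switch (H : StochasticHybridSystem L A X) (s : L × (X → ℝ)) :
    Measure (L × (X → ℝ)) :=
  ∑ e ∈ H.edges, H.edgeDist s e • (H.resetDist e s.2).map (Prod.mk e.2.2)

theorem measurable_switch (H : StochasticHybridSystem L A X) : Measurable H.switch := by
  refine Measure.measurable_of_measurable_coe _ fun B hB => ?_
  simp only [switch, Measure.finsetSum_apply, Measure.smul_apply, smul_eq_mul]
  refine Finset.measurable_sum _ fun e he => (H.measurable_edgeDist e he).mul ?_
  have h : ∀ s : L × (X → ℝ), (H.resetDist e s.2).map (Prod.mk e.2.2) B =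
      H.resetDist e s.2 (Prod.mk e.2.2 ⁻¹' B) := fun s =>
    Measure.map_apply measurable_prodMk_left hB
  refine Eq.subst (motive := Measurable) (funext h).symm ?_
  exact ((H.resetDist e).measurable_coe (measurable_prodMk_left hB)).comp measurable_snd

theorem measurable_delayState (H : StochasticHybridSystem L A X) :
    Measurable fun p : (L × (X → ℝ)) × ℝ≥0 => H.delayState p.1 p.2 := by
  refine Measurable.prodMk (measurable_fst.comp measurable_fst) ?_
  have h : Measurable fun q : L × ((X → ℝ) × ℝ≥0) => H.flow q.1 q.2.1 q.2.2 :=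
    measurable_from_prod_countable_right fun ℓ => (H.continuous_flow ℓ).measurable
  exact h.comp (f := fun p : (L × (X → ℝ)) × ℝ≥0 => (p.1.1, (p.1.2, p.2))) (by fun_prop)

/-- The distribution of the next state from the state `s`, which is not blocked: let a random
delay elapse, then take a discrete transition. -/
noncomputable def delayThenSwitch (H : StochasticHybridSystem L A X) :
    Kernel (L × (X → ℝ)) (L × (X → ℝ)) where
  toFun s := (H.delayDist s).bind fun τ => H.switch (H.delayState s τ)
  measurable' := by
    have hm := H.measurable_switch.comp H.measurable_delayState
    refine Measure.measurable_of_measurable_coe _ fun B hB => ?_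
    have h : ∀ s, (H.delayDist s).bind (fun τ => H.switch (H.delayState s τ)) B =
        ∫⁻ τ, H.switch (H.delayState s τ) B ∂(H.delayDist s) := fun s =>
      Measure.bind_apply hB (hm.comp measurable_prodMk_left).aemeasurable
    refine Eq.subst (motive := Measurable) (funext h).symm ?_
    exact ((Measure.measurable_coe hB).comp hm).lintegral_kernel_prod_right'

theorem delayThenSwitch_apply (H : StochasticHybridSystem L A X) (s : L × (X → ℝ))
    {B : Set (L × (X → ℝ))} (hB : MeasurableSet B) :
    H.delayThenSwitch s B = ∫⁻ τ, ∑ e ∈ H.edges, H.edgeDist (H.delayState s τ) e *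
      H.resetDist e (H.flow s.1 s.2 τ) {v' | (e.2.2, v') ∈ B} ∂(H.delayDist s) := by
  have hm := (H.measurable_switch.comp H.measurable_delayState).comp
    (measurable_prodMk_left (x := s))
  refine (Measure.bind_apply hB hm.aemeasurable).trans (lintegral_congr fun τ => ?_)
  change H.switch (H.delayState s τ) B = _
  simp only [switch, Measure.finsetSum_apply, Measure.smul_apply, smul_eq_mul,
    Measure.map_apply measurable_prodMk_left hB]
  rfl

open Classical in
/-- The transition kernel: a delay followed by a discrete transition. If the hybrid system has
blocked states, these are absorbing. -/
noncomputable def transitionKernel (H : StochasticHybridSystem L A X) :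
    Kernel (L × (X → ℝ)) (L × (X → ℝ)) :=
  Kernel.piecewise H.measurableSet_blocked Kernel.id H.delayThenSwitch

theorem isMarkovKernel_transitionKernel (H : StochasticHybridSystem L A X) :
    IsMarkovKernel H.transitionKernel := by
  refine ⟨fun s => ⟨?_⟩⟩
  by_cases hs : s ∈ H.blocked
  · simp [transitionKernel, Kernel.piecewise_apply, hs, Kernel.id_apply]
  · simp only [transitionKernel, Kernel.piecewise_apply, hs, if_false]
    rw [delayThenSwitch_apply H s MeasurableSet.univ]
    refine (lintegral_congr_ae (g := fun _ => 1) ?_).trans (by simp)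
    filter_upwards [H.delayDist_delays s hs] with τ hτ
    obtain ⟨e₀, -, he₀⟩ := hτ
    rw [← H.sum_edgeDist _ ⟨e₀, he₀⟩]
    refine Finset.sum_congr rfl fun e he => ?_
    rcases (zero_le (a := H.edgeDist (H.delayState s τ) e)).eq_or_lt with h0 | h0
    · simp [← h0]
    · have := H.isProbabilityMeasure_resetDist e he _
        ((H.edgeDist_pos_iff _ ⟨e₀, he₀⟩ e he).1 h0).2.2
      have h1 : H.resetDist e (H.flow s.1 s.2 τ) Set.univ = 1 := this.measure_univ
      simp [h1]

/-- The stochastic transition system induced by `H`; its set of states is `L × (X → ℝ)`, with the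
product of the discrete and the Borel σ-algebras. -/
noncomputable def toSTS (H : StochasticHybridSystem L A X) : STS (L × (X → ℝ)) where
  kernel := H.transitionKernel
  isMarkov := H.isMarkovKernel_transitionKernel

/-- The edge `e` has a strong reset: the set of valuations after the reset and the distribution on
it do not depend on the valuation before. -/
def StronglyReset (H : StochasticHybridSystem L A X) (e : L × A × L) : Prop :=
  ∃ (R : Set (X → ℝ)) (η : Measure (X → ℝ)), IsProbabilityMeasure η ∧ (∀ᵐ v' ∂η, v' ∈ R) ∧
    ∀ v ∈ H.guard e, H.resetSet e v = R ∧ H.resetDist e v = η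

/-- Every cycle of the discrete graph contains a strongly reset edge. -/
def CycleReset (H : StochasticHybridSystem L A X) : Prop :=
  ∀ (k : ℕ) (c : Fin (k + 1) → L × A × L), H.IsCycle c → ∃ i, H.StronglyReset (c i)

end StochasticHybridSystem

/-! ### Runs of a Markov chain -/

namespace STS

variable {S : Type*} [MeasurableSpace S]

/-! Put `D = B ∪ T.avoid B` and let `h s` be the probability of never visiting `D` from `s`
(`avoidProb`). Decisiveness says that `h` integrates to `0` against every initial law.

Pointwise `h < 1`: on the avoid-set `h` vanishes, and elsewhere `B` itself is visited with positive
probability (`avoidProb_union_avoid_lt_one`). This alone is not enough; a uniform bound `h ≤ c < 1`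
is. Indeed, avoiding `D` forever means avoiding it for `n` steps and then forever, so `h ≤ c *
avoidUpTo n`, and in the limit `h ≤ c * h` (`avoidProb_eq_zero_of_le`).

Strong resets supply the uniform bound: after such an edge the mean of `h` is a constant `∫ h dη* <
1`, and there are finitely many edges, so one `c < 1` serves for all
(`exists_lintegral_le_of_stronglyReset`). The remaining edges form no cycle, so the bound propagates
backwards along them by well-founded induction on locations (`wellFounded_of_isCycle`), since
outside `D` the value of `h` is its mean after one transition. -/

instance (T : STS S) (μ : Measure S) [IsProbabilityMeasure μ] :
    IsProbabilityMeasure (T.prob μ) :=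
  inferInstanceAs (IsProbabilityMeasure (Kernel.trajMeasure (X := fun _ : ℕ => S) μ _))

/-- The law of the initial state of a run. -/
theorem map_prob_zero (T : STS S) (μ : Measure S) [IsProbabilityMeasure μ] :
    (T.prob μ).map (fun ρ => ρ 0) = μ := by
  have hf : (fun ρ : ℕ → S => ρ 0) =
      (fun x : (_ : Finset.Iic 0) → S => x ⟨0, Finset.mem_Iic.2 le_rfl⟩) ∘
        Preorder.frestrictLe (π := fun _ : ℕ => S) 0 := rfl
  rw [hf, ← Measure.map_map (measurable_pi_apply _) (by fun_prop), prob, Kernel.trajMeasure,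
    Measure.map_comp _ _ (by fun_prop), Kernel.traj_map_frestrictLe, Kernel.partialTraj_self,
    Measure.id_comp, Measure.map_map (measurable_pi_apply _) (MeasurableEquiv.measurable _)]
  exact Measure.map_id

/-- The Markov property at time `n`, integrated. -/
theorem lintegral_prob_succ (T : STS S) (μ : Measure S) [IsProbabilityMeasure μ] (n : ℕ)
    {F : ((_ : Finset.Iic n) → S) → S → ℝ≥0∞} (hF : Measurable F.uncurry) :
    ∫⁻ ρ, F (Preorder.frestrictLe n ρ) (ρ (n + 1)) ∂T.prob μ =
      ∫⁻ ρ, ∫⁻ s, F (Preorder.frestrictLe n ρ) s ∂T.kernel (ρ n) ∂T.prob μ := by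
  have key := Kernel.map_frestrictLe_trajMeasure_compProd_eq_map_trajMeasure
    (X := fun _ : ℕ => S) (μ₀ := μ) (κ := T.historyKernel) (a := n)
  have h := congrArg (fun ν => ∫⁻ p, F.uncurry p ∂ν) key
  rw [Measure.lintegral_compProd hF, lintegral_map hF (by fun_prop),
    lintegral_map hF.lintegral_kernel_prod_right' (by fun_prop)] at h
  exact h.symm

/-! ### Avoidance probabilities -/

/-- The probability of avoiding `C` at the times `0, …, n` as a function of the initial state,
defined by recursion on `n`. -/
noncomputable def avoidUpTo (T : STS S) (C : Set S) : ℕ → S → ℝ≥0∞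
  | 0 => Cᶜ.indicator 1
  | n + 1 => Cᶜ.indicator fun s => ∫⁻ s', avoidUpTo T C n s' ∂T.kernel s

variable {T : STS S} {C : Set S}

theorem measurable_avoidUpTo (hC : MeasurableSet C) : ∀ n, Measurable (T.avoidUpTo C n)
  | 0 => measurable_one.indicator hC.compl
  | n + 1 => ((measurable_avoidUpTo hC n).lintegral_kernel).indicator hC.compl

theorem avoidUpTo_of_mem {s : S} (hs : s ∈ C) : ∀ n, T.avoidUpTo C n s = 0
  | 0 => by simp [avoidUpTo, hs]
  | n + 1 => by simp [avoidUpTo, hs]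

theorem avoidUpTo_le_one (s : S) : ∀ n, T.avoidUpTo C n s ≤ 1
  | 0 => Set.indicator_le_self' (by simp) s
  | n + 1 => by
    refine (Set.indicator_le_self' (by simp) s).trans ?_
    exact (lintegral_mono fun s' => avoidUpTo_le_one s' n).trans (by simp)

theorem antitone_avoidUpTo : Antitone (T.avoidUpTo C) := by
  refine antitone_nat_of_succ_le fun n => ?_
  induction n with
  | zero =>
    refine fun s => Set.indicator_le_indicator' (fun _ => ?_)
    exact (lintegral_mono fun s' => avoidUpTo_le_one s' 0).trans (by simp)
  | succ n ih => exact fun s => Set.indicator_le_indicator' (fun _ => lintegral_mono ih)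

theorem measurableSet_forall_notMem {ι : Type*} [Countable ι] (hC : MeasurableSet C) :
    MeasurableSet {x : ι → S | ∀ i, x i ∉ C} := by
  have h : {x : ι → S | ∀ i, x i ∉ C} = ⋂ i, (fun x => x i) ⁻¹' Cᶜ := by ext; simp
  rw [h]
  exact .iInter fun i => measurable_pi_apply i hC.compl

theorem measurableSet_forall_le_notMem (hC : MeasurableSet C) (n : ℕ) :
    MeasurableSet {ρ : ℕ → S | ∀ i ≤ n, ρ i ∉ C} := by
  have h : {ρ : ℕ → S | ∀ i ≤ n, ρ i ∉ C} = ⋂ i, ⋂ (_ : i ≤ n), (fun ρ => ρ i) ⁻¹' Cᶜ := by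
    ext; simp
  rw [h]
  exact .iInter fun i => .iInter fun _ => measurable_pi_apply i hC.compl

/-- Links the recursion to the run measure: the Markov property trades one step of the run for one
step of `avoidUpTo`. Time `n` is tested on both sides of the split, harmlessly, so `avoidUpTo m`
covers the times `n, …, n + m`. The case `m = 0` is the one used for `prob_compl_eventually`. -/
theorem setLIntegral_avoidUpTo (hC : MeasurableSet C) (μ : Measure S) [IsProbabilityMeasure μ]
    (n m : ℕ) : ∫⁻ ρ in {ρ | ∀ i ≤ n, ρ i ∉ C}, T.avoidUpTo C m (ρ n) ∂T.prob μ =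
      ∫⁻ s, T.avoidUpTo C (n + m) s ∂μ := by
  have hA := measurableSet_forall_le_notMem hC
  induction n generalizing m with
  | zero =>
    rw [← lintegral_indicator (hA 0), zero_add]
    conv_rhs => rw [← T.map_prob_zero μ,
      lintegral_map (measurable_avoidUpTo hC m) (measurable_pi_apply 0)]
    refine lintegral_congr fun ρ => ?_
    by_cases h : ρ 0 ∈ C
    · simp [avoidUpTo_of_mem h]
    · exact Set.indicator_of_mem (by simpa using h) _
  | succ n ih =>
    have hD : MeasurableSet {x : (_ : Finset.Iic n) → S | ∀ i, x i ∉ C} :=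
      measurableSet_forall_notMem hC
    have hiff : ∀ ρ : ℕ → S, Preorder.frestrictLe (π := fun _ : ℕ => S) n ρ ∈
        {x : (_ : Finset.Iic n) → S | ∀ i, x i ∉ C} ↔ ρ ∈ {ρ : ℕ → S | ∀ i ≤ n, ρ i ∉ C} :=
      fun ρ => ⟨fun h i hi => h ⟨i, Finset.mem_Iic.2 hi⟩, fun h i => h i (Finset.mem_Iic.1 i.2)⟩
    have hstep := T.lintegral_prob_succ μ n
      (F := fun x s => {x : (_ : Finset.Iic n) → S | ∀ i, x i ∉ C}.indicator 1 x *
        T.avoidUpTo C m s)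
      (((measurable_one.indicator hD).comp measurable_fst).mul
        ((measurable_avoidUpTo hC m).comp measurable_snd))
    rw [← lintegral_indicator (hA _), add_right_comm, add_assoc, ← ih, ← lintegral_indicator (hA _)]
    refine Eq.trans (lintegral_congr fun ρ => ?_) (hstep.trans (lintegral_congr fun ρ => ?_))
    · by_cases h : ρ ∈ {ρ : ℕ → S | ∀ i ≤ n, ρ i ∉ C}
      · rw [Set.indicator_of_mem ((hiff ρ).2 h), Pi.one_apply, one_mul]
        by_cases h' : ρ (n + 1) ∈ C
        · simp [avoidUpTo_of_mem h']
        · refine Set.indicator_of_mem (fun i hi => ?_) _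
          rcases Nat.le_succ_iff.1 hi with hi | rfl
          exacts [h i hi, h']
      · rw [Set.indicator_of_notMem (fun h' => h ((hiff ρ).1 h')), zero_mul]
        exact Set.indicator_of_notMem (fun (h' : ∀ i ≤ n + 1, ρ i ∉ C) =>
          h fun i hi => h' i (hi.trans n.le_succ)) _
    · by_cases h : ρ ∈ {ρ : ℕ → S | ∀ i ≤ n, ρ i ∉ C}
      · rw [Set.indicator_of_mem ((hiff ρ).2 h), Set.indicator_of_mem h]
        have hn : ρ n ∈ Cᶜ := h n le_rfl
        simp [avoidUpTo, hn]
      · rw [Set.indicator_of_notMem (fun h' => h ((hiff ρ).1 h')), Set.indicator_of_notMem h]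
        simp

theorem measurableSet_eventually (hC : MeasurableSet C) : MeasurableSet (eventually C) := by
  have h : eventually C = {ρ : ℕ → S | ∀ i, ρ i ∉ C}ᶜ := by ext; simp [eventually]
  rw [h]
  exact (measurableSet_forall_notMem hC).compl

/-- The probability of never visiting `C` as a function of the initial state. -/
noncomputable def avoidProb (T : STS S) (C : Set S) (s : S) : ℝ≥0∞ := ⨅ n, T.avoidUpTo C n s

theorem measurable_avoidProb (hC : MeasurableSet C) : Measurable (T.avoidProb C) :=
  Measurable.iInf fun n => measurable_avoidUpTo hC n

theorem avoidProb_le_one (s : S) : T.avoidProb C s ≤ 1 :=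
  (iInf_le _ 0).trans (avoidUpTo_le_one s 0)

theorem avoidProb_of_mem {s : S} (hs : s ∈ C) : T.avoidProb C s = 0 :=
  le_antisymm ((iInf_le _ 0).trans (avoidUpTo_of_mem hs 0).le) zero_le

theorem lintegral_avoidProb (hC : MeasurableSet C) (ν : Measure S) [IsProbabilityMeasure ν] :
    ∫⁻ s, T.avoidProb C s ∂ν = ⨅ n, ∫⁻ s, T.avoidUpTo C n s ∂ν := by
  refine lintegral_iInf (measurable_avoidUpTo hC) antitone_avoidUpTo (ne_top_of_le_ne_top
    ENNReal.one_ne_top ((lintegral_mono fun s => avoidUpTo_le_one s 0).trans (by simp)))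

theorem prob_compl_eventually (hC : MeasurableSet C) (μ : Measure S) [IsProbabilityMeasure μ] :
    T.prob μ (eventually C)ᶜ = ∫⁻ s, T.avoidProb C s ∂μ := by
  have hset : (eventually C)ᶜ = ⋂ n, {ρ : ℕ → S | ∀ i ≤ n, ρ i ∉ C} := by
    ext ρ
    simp only [eventually, Set.mem_compl_iff, Set.mem_ofPred_eq, not_exists, Set.mem_iInter]
    exact ⟨fun h n i _ => h i, fun h n => h n n le_rfl⟩
  have hA := measurableSet_forall_le_notMem hC
  have hanti : Antitone fun n => {ρ : ℕ → S | ∀ i ≤ n, ρ i ∉ C} :=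
    fun n m hnm ρ (h : ∀ i ≤ m, ρ i ∉ C) i hi => h i (hi.trans hnm)
  rw [hset, hanti.measure_iInter (fun n => (hA n).nullMeasurableSet) ⟨0, measure_ne_top _ _⟩,
    lintegral_avoidProb hC]
  refine iInf_congr fun n => ?_
  rw [← add_zero n, ← setLIntegral_avoidUpTo hC, ← setLIntegral_one, add_zero]
  refine setLIntegral_congr_fun (hA n) fun ρ h => ?_
  have hn : ρ n ∈ Cᶜ := h n le_rfl
  simp [avoidUpTo, Set.indicator_of_mem hn]

theorem prob_dirac_compl_eventually (hC : MeasurableSet C) (s : S) :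
    T.prob (.dirac s) (eventually C)ᶜ = T.avoidProb C s := by
  rw [prob_compl_eventually hC, lintegral_dirac' _ (measurable_avoidProb hC)]

theorem mem_avoid_iff (hC : MeasurableSet C) {s : S} : s ∈ T.avoid C ↔ T.avoidProb C s = 1 := by
  rw [← prob_dirac_compl_eventually hC, prob_compl_eq_one_iff (measurableSet_eventually hC)]
  rfl

theorem measurableSet_avoid (hC : MeasurableSet C) : MeasurableSet (T.avoid C) := by
  have h : T.avoid C = T.avoidProb C ⁻¹' {1} := Set.ext fun s => mem_avoid_iff hC
  rw [h]
  exact measurable_avoidProb hC (measurableSet_singleton 1)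

theorem avoidProb_anti {D : Set S} (hC : MeasurableSet C) (hD : MeasurableSet D) (h : C ⊆ D)
    (s : S) : T.avoidProb D s ≤ T.avoidProb C s := by
  rw [← prob_dirac_compl_eventually hC, ← prob_dirac_compl_eventually hD]
  exact measure_mono (Set.compl_subset_compl.2 fun ρ ⟨n, hn⟩ => ⟨n, h hn⟩)

/-- Limit of the recursion defining `avoidUpTo`, by monotone convergence; the index shift is
harmless because the sequence decreases. -/
theorem avoidProb_eq_lintegral (hC : MeasurableSet C) {s : S} (hs : s ∉ C) :
    T.avoidProb C s = ∫⁻ s', T.avoidProb C s' ∂T.kernel s := by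
  have hsucc : ∀ n, T.avoidUpTo C (n + 1) s = ∫⁻ s', T.avoidUpTo C n s' ∂T.kernel s := fun n =>
    Set.indicator_of_mem hs _
  rw [lintegral_avoidProb hC]
  simp only [← hsucc]
  exact ((show Antitone fun n => T.avoidUpTo C n s from
    fun n m h => antitone_avoidUpTo h s).iInf_nat_add 1).symm

/-- If the probability of never visiting `C` is bounded away from `1`, then it vanishes. -/
theorem avoidProb_eq_zero_of_le (hC : MeasurableSet C) {c : ℝ≥0∞} (hc : c < 1)
    (h : ∀ s, T.avoidProb C s ≤ c) (s : S) : T.avoidProb C s = 0 := by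
  -- The one-step equation carries the bound `c` from the state at time `n` back to time `0`.
  have hn : ∀ n s, T.avoidProb C s ≤ c * T.avoidUpTo C n s := by
    intro n
    induction n with
    | zero =>
      intro s
      by_cases hs : s ∈ C
      · simp [avoidProb_of_mem hs]
      · simpa [avoidUpTo, hs] using h s
    | succ n ih =>
      intro s
      by_cases hs : s ∈ C
      · simp [avoidProb_of_mem hs]
      · have hs' : s ∈ Cᶜ := hs
        rw [avoidProb_eq_lintegral hC hs, avoidUpTo, Set.indicator_of_mem hs',
          ← lintegral_const_mul _ (measurable_avoidUpTo hC n)]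
        exact lintegral_mono ih
  have hle : T.avoidProb C s ≤ c * T.avoidProb C s := by
    conv_rhs => rw [avoidProb, ENNReal.mul_iInf fun h => absurd h hc.ne_top]
    exact le_iInf fun n => hn n s
  by_contra h0
  have htop : T.avoidProb C s ≠ ∞ := ne_top_of_le_ne_top ENNReal.one_ne_top (avoidProb_le_one s)
  have := ENNReal.mul_lt_mul_left h0 htop hc
  rw [one_mul] at this
  exact this.not_ge hle

/-- An absorbing state outside `C` is never left; this disposes of the blocked states. -/
theorem mem_avoid_of_kernel_eq_dirac (hC : MeasurableSet C) {s : S} (hs : s ∉ C)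
    (hk : T.kernel s = .dirac s) : s ∈ T.avoid C := by
  have hs' : s ∈ Cᶜ := hs
  have h : ∀ n, T.avoidUpTo C n s = 1 := by
    intro n
    induction n with
    | zero => simp [avoidUpTo, hs]
    | succ n ih =>
      rw [avoidUpTo, Set.indicator_of_mem hs', hk,
        lintegral_dirac' _ (measurable_avoidUpTo hC n), ih]
  rw [mem_avoid_iff hC]
  simp [avoidProb, h]

theorem avoidProb_union_avoid_lt_one (hC : MeasurableSet C) (s : S) :
    T.avoidProb (C ∪ T.avoid C) s < 1 := by
  by_cases hs : s ∈ T.avoid C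
  · rw [avoidProb_of_mem (Set.mem_union_right C hs)]
    exact zero_lt_one
  · refine (avoidProb_anti hC (hC.union (measurableSet_avoid hC)) Set.subset_union_left s).trans_lt
      ((avoidProb_le_one s).lt_of_ne fun h => hs ((mem_avoid_iff hC).2 h))

theorem decisive_of_avoidProb_le (hC : MeasurableSet C) {c : ℝ≥0∞} (hc : c < 1)
    (h : ∀ s, T.avoidProb (C ∪ T.avoid C) s ≤ c) : T.Decisive C := by
  intro μ hμ
  have hD := hC.union (measurableSet_avoid (T := T) hC)
  have hset : eventually C ∪ eventually (T.avoid C) = eventually (C ∪ T.avoid C) := by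
    ext ρ
    simp [eventually, exists_or]
  rw [hset, ← prob_compl_eq_zero_iff (measurableSet_eventually hD), prob_compl_eventually hD]
  simp [avoidProb_eq_zero_of_le hD hc h]

end STS

/-! ### Acyclicity outside the strongly reset edges -/

namespace HybridSystem

variable {L A X : Type*} [Finite L] [Finite A] [Finite X]

/-- If every cycle contains an edge with the property `P`, then the relation on locations given
by the edges without this property is well-founded. -/
theorem wellFounded_of_isCycle (H : HybridSystem L A X) {P : L × A × L → Prop}
    (hP : ∀ (k : ℕ) (c : Fin (k + 1) → L × A × L), H.IsCycle c → ∃ i, P (c i)) :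
    WellFounded fun ℓ' ℓ => ∃ e ∈ H.edges, ¬ P e ∧ e.1 = ℓ ∧ e.2.2 = ℓ' := by
  let R : L → L → Prop := fun ℓ ℓ' => ∃ e ∈ H.edges, ¬ P e ∧ e.1 = ℓ ∧ e.2.2 = ℓ'
  -- A chain of `R`-steps is a walk along edges without `P`; a closed one would be a cycle
  -- contradicting `hP`.
  have path : ∀ a b, Relation.TransGen R a b → ∃ (k : ℕ) (c : ℕ → L × A × L),
      (∀ i ≤ k, c i ∈ H.edges ∧ ¬ P (c i)) ∧ (∀ i < k, (c i).2.2 = (c (i + 1)).1) ∧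
        (c 0).1 = a ∧ (c k).2.2 = b := by
    intro a b hab
    induction hab with
    | single h =>
      obtain ⟨e, he, hPe, rfl, rfl⟩ := h
      exact ⟨0, fun _ => e, fun _ _ => ⟨he, hPe⟩, by simp, rfl, rfl⟩
    | tail _ h ih =>
      obtain ⟨k, c, hc, hstep, h0, hk⟩ := ih
      obtain ⟨e, he, hPe, he1, rfl⟩ := h
      refine ⟨k + 1, fun i => if i ≤ k then c i else e, fun i _ => ?_, fun i hi => ?_, by simpa,
        by simp⟩
      · by_cases h : i ≤ k
        · simpa [h] using hc i h
        · simpa [h] using ⟨he, hPe⟩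
      · rcases (Nat.lt_succ_iff.1 hi).lt_or_eq with h | rfl
        · simpa [h.le, Nat.succ_le_of_lt h] using hstep i h
        · simp [hk, he1]
  have hirr : Std.Irrefl (Relation.TransGen (Function.swap R)) := ⟨fun a ha => by
    obtain ⟨k, c, hc, hstep, h0, hk⟩ := path a a (Relation.transGen_swap.1 ha)
    obtain ⟨i, hi⟩ := hP k (fun i => c i) fun i => ⟨(hc i (Nat.lt_succ_iff.1 i.2)).1, by
      rcases (Nat.lt_succ_iff.1 i.2).lt_or_eq with h | h
      · have hv := Fin.val_add_one_of_lt (i := i) (Fin.lt_def.2 (by simpa using h))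
        simp only [hv, hstep i h]
      -- Here `i + 1` wraps around to `0`, where the walk closes up.
      · have : i = Fin.last k := Fin.ext h
        subst this
        simp [hk, h0]⟩
    exact (hc i (Nat.lt_succ_iff.1 i.2)).2 hi⟩
  have := Finite.wellFounded_of_trans_of_irrefl (Relation.TransGen (Function.swap R))
  exact Subrelation.wf (fun h => Relation.TransGen.single h) this

end HybridSystem

/-! ### One-transition estimates -/

namespace StochasticHybridSystem

variable {L A X : Type*} [Finite L] [Finite A] [Finite X]
  [MeasurableSpace L] [DiscreteMeasurableSpace L]

theorem toSTS_kernel_of_mem_blocked (H : StochasticHybridSystem L A X) {s : L × (X → ℝ)}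
    (hs : s ∈ H.blocked) : H.toSTS.kernel s = .dirac s := by
  simp [toSTS, transitionKernel, Kernel.piecewise_apply, hs, Kernel.id_apply]

theorem lintegral_switch (H : StochasticHybridSystem L A X) {f : L × (X → ℝ) → ℝ≥0∞}
    (hf : Measurable f) (s : L × (X → ℝ)) : ∫⁻ s', f s' ∂H.switch s =
      ∑ e ∈ H.edges, H.edgeDist s e * ∫⁻ v, f (e.2.2, v) ∂H.resetDist e s.2 := by
  simp only [switch, lintegral_finsetSum_measure, lintegral_smul_measure, smul_eq_mul,
    lintegral_map hf measurable_prodMk_left]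

/-- A bound on the conditional expectation of `f` after each enabled edge bounds its expectation
after one transition. -/
theorem lintegral_toSTS_kernel_le (H : StochasticHybridSystem L A X) {f : L × (X → ℝ) → ℝ≥0∞}
    (hf : Measurable f) {c : ℝ≥0∞} {s : L × (X → ℝ)} (hs : s ∉ H.blocked)
    (h : ∀ e ∈ H.edges, e.1 = s.1 → ∀ v ∈ H.guard e, ∫⁻ v', f (e.2.2, v') ∂H.resetDist e v ≤ c) :
    ∫⁻ s', f s' ∂H.toSTS.kernel s ≤ c := by
  have hk : H.toSTS.kernel s = (H.delayDist s).bind fun τ => H.switch (H.delayState s τ) := by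
    simp only [toSTS, transitionKernel, Kernel.piecewise_apply, hs, if_false]
    rfl
  have hm : Measurable fun τ => H.switch (H.delayState s τ) :=
    (H.measurable_switch.comp H.measurable_delayState).comp measurable_prodMk_left
  rw [hk, Measure.lintegral_bind hm.aemeasurable hf.aemeasurable]
  refine (lintegral_mono_ae (g := fun _ => c) ?_).trans (by simp)
  filter_upwards [H.delayDist_delays s hs] with τ hτ
  obtain ⟨e₀, -, he₀⟩ := hτ
  rw [H.lintegral_switch hf, ← one_mul c, ← H.sum_edgeDist _ ⟨e₀, he₀⟩, Finset.sum_mul]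
  refine Finset.sum_le_sum fun e he => ?_
  -- Edges that are not enabled have weight `0`, so the bound is needed only where the guard holds.
  rcases (zero_le (a := H.edgeDist (H.delayState s τ) e)).eq_or_lt with h0 | h0
  · simp [← h0]
  · have hen := (H.edgeDist_pos_iff _ ⟨e₀, he₀⟩ e he).1 h0
    exact mul_le_mul_right (h e he hen.2.1 _ hen.2.2) _

/-- The integral after a strong reset is independent of `v`, and a function that is pointwise `< 1`
has mean `< 1` under a probability measure. Finiteness of the edge set keeps the supremum below `1`.
-/
theorem exists_lintegral_le_of_stronglyReset (H : StochasticHybridSystem L A X)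
    {f : L × (X → ℝ) → ℝ≥0∞} (hf : ∀ s, f s < 1) :
    ∃ c < 1, ∀ e ∈ H.edges, H.StronglyReset e → ∀ v ∈ H.guard e,
      ∫⁻ v', f (e.2.2, v') ∂H.resetDist e v ≤ c := by
  have hex : ∀ e, ∃ c < 1, H.StronglyReset e → ∀ v ∈ H.guard e,
      ∫⁻ v', f (e.2.2, v') ∂H.resetDist e v ≤ c := by
    intro e
    by_cases he : H.StronglyReset e
    · obtain ⟨R, η, hη, -, hall⟩ := id he
      have hle : ∫⁻ v', f (e.2.2, v') ∂η ≤ 1 :=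
        (lintegral_mono fun v' => (hf (e.2.2, v')).le).trans (by simp)
      refine ⟨∫⁻ v', f (e.2.2, v') ∂η, ?_, fun _ v hv => by rw [(hall v hv).2]⟩
      have := lintegral_strict_mono (μ := η) (f := fun v' => f (e.2.2, v')) (g := fun _ => 1)
        (IsProbabilityMeasure.ne_zero η) aemeasurable_const
        (ne_top_of_le_ne_top ENNReal.one_ne_top hle) (.of_forall fun v' => hf _)
      simpa using this
    · exact ⟨0, zero_lt_one, fun h => absurd h he⟩
  choose c hc1 hc using hex
  exact ⟨H.edges.sup c, (Finset.sup_lt_iff (by simp)).2 fun e _ => hc1 e,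
    fun e he hs v hv => (hc e hs v hv).trans (Finset.le_sup he)⟩

end StochasticHybridSystem

theorem mainTheorem3 {L A X : Type*} [Finite L] [Finite A] [Finite X]
    [MeasurableSpace L] [DiscreteMeasurableSpace L]
    (H : StochasticHybridSystem L A X) (hH : H.CycleReset)
    (B : Set (L × (X → ℝ))) (hB : MeasurableSet B) :
    H.toSTS.Decisive B := by
  have hC := hB.union (STS.measurableSet_avoid (T := H.toSTS) hB)
  obtain ⟨c, hc1, hc⟩ := H.exists_lintegral_le_of_stronglyReset
    (f := H.toSTS.avoidProb (B ∪ H.toSTS.avoid B)) (STS.avoidProb_union_avoid_lt_one hB)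
  refine STS.decisive_of_avoidProb_le hB hc1 ?_
  suffices h : ∀ ℓ v, H.toSTS.avoidProb (B ∪ H.toSTS.avoid B) (ℓ, v) ≤ c from fun s => h s.1 s.2
  intro ℓ
  -- The hypothesis `ih` gives the bound at the targets of the edges out of `ℓ` that are not
  -- strongly reset.
  induction ℓ using (H.wellFounded_of_isCycle hH).induction with
  | _ ℓ ih =>
    intro v
    by_cases hs : (ℓ, v) ∈ B ∪ H.toSTS.avoid B
    · simp [STS.avoidProb_of_mem hs]
    · rw [STS.avoidProb_eq_lintegral hC hs]
      -- A blocked state outside `B` is absorbing, hence in the avoid-set, which `hs` excludes.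
      refine H.lintegral_toSTS_kernel_le (STS.measurable_avoidProb hC) (fun hbl => hs (Or.inr
        (STS.mem_avoid_of_kernel_eq_dirac hB (fun h => hs (Or.inl h))
          (H.toSTS_kernel_of_mem_blocked hbl)))) fun e he hℓ w hw => ?_
      by_cases hr : H.StronglyReset e
      · exact hc e he hr w hw
      · have := H.isProbabilityMeasure_resetDist e he w hw
        exact (lintegral_mono (g := fun _ => c) (ih _ ⟨e, he, hr, hℓ, rfl⟩)).trans (by simp)
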